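/- Let $\mathbb F$ be a field and let $\mathcal C$ be an $(n,k)$ convolutional code over $\mathbb F$, i.e. a $k$-dimensional $\mathbb F((D))$-subspace of $\mathbb F((D))^n$ having a basis in $\mathbb F(D)^n$. For a vector $\mathbf v$ of Laurent series, $\mathbf v=\sum_j v_jD^j$ with $v_j\in\mathbb F^n$, let $\mathcal K(\mathbf v)=\sum_{j\ge 0}v_jD^j$ be its causal part. Put $\mathcal C^*=\{\mathbf v\in\mathcal C : \mathcal K(\mathbf v)\in\mathcal C\}$, let $\Sigma_{\mathcal C}=\mathcal C/\mathcal C^*$ be the code state space (a vector space over $\mathbb F$), and write $[\mathbf v]_{\mathcal C}=\mathbf v+\mathcal C^*$. A polynomial generating matrix of $\mathcal C$ is a matrix $\mathbf G\in\mathbb F[D]^{k\times n}$ of rank $k$ whose rows $\mathbf g_1,\dots,\mathbf g_k$ generate $\mathcal C$ over $\mathbb F((D))$; the degree $\deg\mathbf g_i$ of a row is the maximal degree of its entries, and the external degree of $\mathbf G$ is $\sum_{i}\deg\mathbf g_i$. It is called canonical if its external degree is minimal among all polynomial generating matrices of $\mathcal C$, its rows being numbered so that $\deg\mathbf g_1\le\dots\le\deg\mathbf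 g_k$. The Forney indices $(e_1,\dots,e_k)$ of $\mathcal C$ are the row degrees, in this order, of a canonical generating matrix of $\mathcal C$ (they do not depend on the choice of that matrix). If $\mathbf G$ is any canonical generating matrix of $\mathcal C$, then the classes $$[D^{-j}\mathbf g_i]_{\mathcal C},\qquad i=1,\dots,k,\quad j=1,\dots,e_i,$$ are pairwise distinct and form a basis of $\Sigma_{\mathcal C}$ over $\mathbb F$. Hence $\dim_{\mathbb F}\Sigma_{\mathcal C}=\sum_{i=1}^k e_i$. -/

import Mathlib

open scoped LaurentSeries Polynomial

noncomputable section

namespace ConvCode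

variable {F : Type*} [Field F] {n k : ℕ}

/-- The coefficientwise action of `F` on Laurent series is compatible with multiplication. -/
instance isScalarTower_laurentSeries : IsScalarTower F F⸨X⸩ F⸨X⸩ where
  smul_assoc r x y := by
    simp only [smul_eq_mul, ← HahnSeries.single_zero_mul_eq_smul, mul_assoc]

/-- An `(n,k)` convolutional code: a `k`-dimensional subspace of `F((D))^n` that has a basis
consisting of vectors of rational functions. -/
def IsConvolutionalCode (k : ℕ) (C : Submodule F⸨X⸩ (Fin n → F⸨X⸩)) : Prop :=
  ∃ g : Fin k → Fin n → RatFunc F,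
    LinearIndependent F⸨X⸩ (fun i j => ((g i j : RatFunc F) : F⸨X⸩)) ∧
    Submodule.span F⸨X⸩ (Set.range fun i j => ((g i j : RatFunc F) : F⸨X⸩)) = C

/-- The `i`-th row of a polynomial matrix, as a vector of Laurent series. -/
def laurentRow (G : Matrix (Fin k) (Fin n) F[X]) (i : Fin k) : Fin n → F⸨X⸩ :=
  fun j => algebraMap F[X] F⸨X⸩ (G i j)

/-- `G` is a polynomial generating matrix of `C`: it has rank `k` and its rows generate `C`.
(Polynomials are causal rational series.) -/
structure IsPolyGeneratingMatrix (C : Submodule F⸨X⸩ (Fin n → F⸨X⸩))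
    (G : Matrix (Fin k) (Fin n) F[X]) : Prop where
  linearIndependent : LinearIndependent F⸨X⸩ (laurentRow G)
  span_eq : Submodule.span F⸨X⸩ (Set.range (laurentRow G)) = C

/-- The degree of the `i`-th row: the maximal degree of its entries. Rows of a generating matrix
are nonzero, so the convention `natDegree 0 = 0` does not affect the maximum for them. -/
def rowDeg (G : Matrix (Fin k) (Fin n) F[X]) (i : Fin k) : ℕ :=
  Finset.univ.sup fun j => (G i j).natDegree

/-- The external degree: the sum of the row degrees. -/
def extDeg (G : Matrix (Fin k) (Fin n) F[X]) : ℕ := ∑ i, rowDeg G i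

/-- `G` is a canonical generating matrix of `C`: a polynomial generating matrix, with rows
numbered by nondecreasing degree, whose external degree is minimal among all polynomial
generating matrices of `C`. -/
structure IsCanonical (C : Submodule F⸨X⸩ (Fin n → F⸨X⸩))
    (G : Matrix (Fin k) (Fin n) F[X]) : Prop where
  isPolyGeneratingMatrix : IsPolyGeneratingMatrix C G
  monotone_rowDeg : Monotone (rowDeg G)
  extDeg_le : ∀ G' : Matrix (Fin k) (Fin n) F[X],
    IsPolyGeneratingMatrix C G' → extDeg G ≤ extDeg G'

/-- `e` is the tuple of Forney indices of `C`: the nondecreasing tuple of row degrees of some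
canonical generating matrix of `C`. -/
def IsForneyIndices (C : Submodule F⸨X⸩ (Fin n → F⸨X⸩)) (e : Fin k → ℕ) : Prop :=
  ∃ G : Matrix (Fin k) (Fin n) F[X], IsCanonical C G ∧ ∀ i, rowDeg G i = e i

/-- The causal part `∑_{j ≥ 0} u_j D^j` of a Laurent series `u`. -/
def causalPart : F⸨X⸩ →ₗ[F] F⸨X⸩ :=
  LinearMap.id - HahnSeries.truncLTLinearMap F 0

theorem coeff_causalPart (u : F⸨X⸩) (j : ℤ) :
    (causalPart u).coeff j = if 0 ≤ j then u.coeff j else 0 := by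
  by_cases h : 0 ≤ j
  · simp [causalPart, HahnSeries.coeff_truncLT, h, not_lt.mpr h]
  · simp [causalPart, HahnSeries.coeff_truncLT, h, not_le.mp h]

/-- The causal part of a vector of Laurent series. -/
def causalPartVec : (Fin n → F⸨X⸩) →ₗ[F] (Fin n → F⸨X⸩) :=
  causalPart.compLeft (Fin n)

/-- `C^* = {v ∈ C | the causal part of v lies in C}`, an `F`-subspace of `C`. -/
def stateZero (C : Submodule F⸨X⸩ (Fin n → F⸨X⸩)) : Submodule F (C.restrictScalars F) :=
  ((C.restrictScalars F).comap causalPartVec).comap (C.restrictScalars F).subtype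

/-- The state space `C / C^*` of the code, a vector space over `F`. -/
abbrev StateSpace (C : Submodule F⸨X⸩ (Fin n → F⸨X⸩)) : Type _ :=
  (C.restrictScalars F) ⧸ stateZero C

/-- The class of a codeword `v` in the state space. -/
def stateClass (C : Submodule F⸨X⸩ (Fin n → F⸨X⸩)) (v : Fin n → F⸨X⸩) (hv : v ∈ C) :
    StateSpace C :=
  (stateZero C).mkQ ⟨v, hv⟩

/-- The vector `D^m g_i` for an integer `m`; `D^m` is the Laurent series `single m 1`. -/
def shiftRow (G : Matrix (Fin k) (Fin n) F[X]) (i : Fin k) (m : ℤ) : Fin n → F⸨X⸩ :=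
  (HahnSeries.single m (1 : F) : F⸨X⸩) • laurentRow G i

theorem IsPolyGeneratingMatrix.shiftRow_mem {C : Submodule F⸨X⸩ (Fin n → F⸨X⸩)}
    {G : Matrix (Fin k) (Fin n) F[X]} (hG : IsPolyGeneratingMatrix C G) (i : Fin k) (m : ℤ) :
    shiftRow G i m ∈ C :=
  C.smul_mem _ (hG.span_eq ▸ Submodule.subset_span ⟨i, rfl⟩)

end ConvCode

end

namespace ConvCode

variable {F : Type*} [Field F] {n k : ℕ}

/-! Minimality of the external degree enters only through an exchange argument
(`IsCanonical.rowDeg_le`). After a shift, it says that a codeword supported in a window of length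
`d` has zero coefficient on every row of degree at least `d` (`IsCanonical.eq_zero_of_support`). For
independence, let a combination `v = ∑ u i • g i` of the listed shifts have zero class, and let `d`
be the largest degree of a row with `u i ≠ 0`. Then `v` lives in `[-d, d)`, and its causal and
anticausal parts are codewords in two windows of length `d`. Neither involves that row, so `u i =
0`. Spanning needs no minimality: causal multiples of a row, and shifts by at least one more than
its degree to the left, have zero class. -/

theorem coeff_algebraMap_polynomial (p : F[X]) (m : ℤ) :
    (algebraMap F[X] F⸨X⸩ p).coeff m = if m < 0 then 0 else p.coeff m.natAbs := by
  rw [Polynomial.algebraMap_hahnSeries_apply, PowerSeries.coeff_coe, Polynomial.coeff_coe]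

/-- A Laurent series supported in `[0, d)` is a polynomial of degree less than `d`. -/
theorem exists_polynomial_of_support {d : ℕ} (hd : 0 < d) (x : F⸨X⸩)
    (hx : ∀ m, x.coeff m ≠ 0 → 0 ≤ m ∧ m < d) :
    ∃ p : F[X], algebraMap F[X] F⸨X⸩ p = x ∧ p.natDegree < d := by
  refine ⟨∑ m ∈ Finset.range d, Polynomial.monomial m (x.coeff m), ?_, ?_⟩
  · ext m
    rw [coeff_algebraMap_polynomial]
    by_cases hm : x.coeff m = 0
    · rw [hm, ite_eq_left_iff]
      intro h0
      obtain ⟨a, rfl⟩ := Int.eq_ofNat_of_zero_le (not_lt.mp h0)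
      simp_all [Polynomial.coeff_monomial]
    · obtain ⟨h0, h1⟩ := hx m hm
      obtain ⟨a, rfl⟩ := Int.eq_ofNat_of_zero_le h0
      have ha : a < d := by exact_mod_cast h1
      simp [Polynomial.coeff_monomial, ha]
  · refine (Nat.le_sub_one_iff_lt hd).mp ?_
    refine Polynomial.natDegree_sum_le_of_forall_le _ _ fun m hm => ?_
    exact (Polynomial.natDegree_monomial_le _).trans (by have := Finset.mem_range.mp hm; omega)

/-- Exchange property: a polynomial codeword that involves the `i`-th row of a canonical
generating matrix has at least the degree of that row, for it could replace the row. -/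
theorem IsCanonical.rowDeg_le {C : Submodule F⸨X⸩ (Fin n → F⸨X⸩)}
    {G : Matrix (Fin k) (Fin n) F[X]} (hG : IsCanonical C G) (p : Fin n → F[X])
    (c : Fin k → F⸨X⸩)
    (hp : ∑ l, c l • laurentRow G l = fun j => algebraMap F[X] F⸨X⸩ (p j))
    {i : Fin k} (hi : c i ≠ 0) :
    rowDeg G i ≤ Finset.univ.sup fun j => (p j).natDegree := by
  classical
  obtain ⟨⟨hli, hspan⟩, -, hmin⟩ := hG
  have hrow : laurentRow (G.updateRow i p)
      = Function.update (laurentRow G) i fun j => algebraMap F[X] F⸨X⸩ (p j) := by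
    ext l j
    by_cases h : l = i
    · subst h; simp [laurentRow]
    · simp [laurentRow, h]
  have hdeg : rowDeg (G.updateRow i p)
      = Function.update (rowDeg G) i (Finset.univ.sup fun j => (p j).natDegree) := by
    ext l
    by_cases h : l = i
    · subst h; simp [rowDeg]
    · simp [rowDeg, h]
  have hmem : ∀ l, laurentRow (G.updateRow i p) l ∈
      Submodule.span F⸨X⸩ (Set.range (laurentRow (G.updateRow i p))) :=
    fun l => Submodule.subset_span ⟨l, rfl⟩
  have hother : ∀ l, l ≠ i → laurentRow G l ∈
      Submodule.span F⸨X⸩ (Set.range (laurentRow (G.updateRow i p))) := by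
    intro l hl
    have := hmem l
    rwa [congrFun hrow l, Function.update_of_ne hl] at this
  have hspan' : Submodule.span F⸨X⸩ (Set.range (laurentRow (G.updateRow i p))) = C := by
    apply le_antisymm
    · rw [Submodule.span_le]
      rintro _ ⟨l, rfl⟩
      rw [← hspan]
      by_cases h : l = i
      · subst h
        rw [hrow, Function.update_self, ← hp]
        exact Submodule.sum_mem _ fun m _ =>
          Submodule.smul_mem _ _ (Submodule.subset_span ⟨m, rfl⟩)
      · rw [hrow, Function.update_of_ne h]
        exact Submodule.subset_span ⟨l, rfl⟩
    · rw [← hspan, Submodule.span_le]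
      rintro _ ⟨l, rfl⟩
      by_cases h : l = i
      · subst h
        -- As `c l` is invertible, the old row can be solved for in terms of the new one and the
        -- remaining rows.
        have hl := hmem l
        rw [congrFun hrow l, Function.update_self, ← hp,
          ← Finset.add_sum_erase _ _ (Finset.mem_univ l)] at hl
        have hrest := Submodule.sum_mem _ fun m (hm : m ∈ Finset.univ.erase l) =>
          Submodule.smul_mem _ (c m) (hother m (Finset.ne_of_mem_erase hm))
        exact (Submodule.smul_mem_iff _ hi).mp ((Submodule.add_mem_iff_left _ hrest).mp hl)
      · exact hother l h
  -- Both families have `k` members and the same span, so independence passes from one to the other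
  -- by dimension.
  have hli' : LinearIndependent F⸨X⸩ (laurentRow (G.updateRow i p)) := by
    rw [linearIndependent_iff_card_eq_finrank_span] at hli ⊢
    rw [hli, Set.finrank, Set.finrank, hspan, hspan']
  have hle := hmin _ ⟨hli', hspan'⟩
  rw [extDeg, extDeg, hdeg, Finset.sum_update_of_mem (Finset.mem_univ i),
    ← Finset.add_sum_erase _ _ (Finset.mem_univ i), ← Finset.erase_eq] at hle
  exact Nat.le_of_add_le_add_right hle

/-- A codeword supported in a window of length `d` does not involve the rows of degree at
least `d` of a canonical generating matrix. -/
theorem IsCanonical.eq_zero_of_support {C : Submodule F⸨X⸩ (Fin n → F⸨X⸩)}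
    {G : Matrix (Fin k) (Fin n) F[X]} (hG : IsCanonical C G) {d : ℕ} (hd : 0 < d) (a : ℤ)
    (c : Fin k → F⸨X⸩)
    (hc : ∀ j m, ((∑ l, c l • laurentRow G l) j).coeff m ≠ 0 → a ≤ m ∧ m < a + d)
    {i : Fin k} (hi : d ≤ rowDeg G i) : c i = 0 := by
  have hpoly : ∀ j, ∃ p : F[X], algebraMap F[X] F⸨X⸩ p
      = HahnSeries.single (-a) (1 : F) * (∑ l, c l • laurentRow G l) j ∧ p.natDegree < d := by
    intro j
    refine exists_polynomial_of_support hd _ fun m hm => ?_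
    rw [HahnSeries.coeff_single_mul, one_mul] at hm
    have := hc j _ hm
    constructor <;> linarith
  choose p hp hpd using hpoly
  by_contra hci
  have hne : (HahnSeries.single (-a) (1 : F) : F⸨X⸩) * c i ≠ 0 :=
    mul_ne_zero (by simp) hci
  have hle := hG.rowDeg_le p (fun l => HahnSeries.single (-a) (1 : F) * c l) (by
    ext1 j
    rw [hp j]
    simp [Finset.mul_sum, mul_assoc]) hne
  have : (Finset.univ.sup fun j => (p j).natDegree) < d :=
    (Finset.sup_lt_iff (by simpa using hd)).mpr fun j _ => hpd j
  omega

/-- The row degrees of a canonical generating matrix are dominated by those of any other. -/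
theorem IsCanonical.rowDeg_le_rowDeg {C : Submodule F⸨X⸩ (Fin n → F⸨X⸩)}
    {G G' : Matrix (Fin k) (Fin n) F[X]} (hG : IsCanonical C G) (hG' : IsCanonical C G')
    (i : Fin k) : rowDeg G i ≤ rowDeg G' i := by
  by_contra! hlt
  -- By exchange, rows of `G'` up to `i` can use only rows of `G` of degree below `rowDeg G i`,
  -- hence with index below `i`. That puts `i + 1` independent vectors in the span of `i` vectors.
  have hmem : Submodule.span F⸨X⸩ (Set.range fun l : Set.Iic i => laurentRow G' l) ≤
      Submodule.span F⸨X⸩ (Set.range fun l : Set.Iio i => laurentRow G l) := by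
    rw [Submodule.span_le]
    rintro _ ⟨⟨l, hl⟩, rfl⟩
    have hC : laurentRow G' l ∈ Submodule.span F⸨X⸩ (Set.range (laurentRow G)) := by
      rw [hG.isPolyGeneratingMatrix.span_eq, ← hG'.isPolyGeneratingMatrix.span_eq]
      exact Submodule.subset_span ⟨l, rfl⟩
    obtain ⟨c, hc⟩ := (Submodule.mem_span_range_iff_exists_fun _).mp hC
    change laurentRow G' l ∈ _
    rw [← hc]
    refine Submodule.sum_mem _ fun m _ => ?_
    by_cases hm : c m = 0
    · simp [hm]
    · have h1 : rowDeg G m ≤ rowDeg G' l := hG.rowDeg_le (G' l) c hc hm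
      have h2 : rowDeg G' l ≤ rowDeg G' i := hG'.monotone_rowDeg hl
      have hmi : m < i := by
        by_contra! h
        have := hG.monotone_rowDeg h
        omega
      exact Submodule.smul_mem _ _ (Submodule.subset_span ⟨⟨m, hmi⟩, rfl⟩)
  have hli : LinearIndependent F⸨X⸩ (fun l : Set.Iic i => laurentRow G' l) :=
    hG'.isPolyGeneratingMatrix.linearIndependent.comp _ Subtype.val_injective
  have h1 := finrank_span_eq_card hli
  have h2 := finrank_range_le_card (R := F⸨X⸩) (fun l : Set.Iio i => laurentRow G l)
  have h3 := Submodule.finrank_mono hmem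
  rw [Set.finrank] at h2
  have c1 : Fintype.card (Set.Iic i) = i + 1 := by simp
  have c2 : Fintype.card (Set.Iio i) = i := by simp
  omega

theorem IsCanonical.rowDeg_eq {C : Submodule F⸨X⸩ (Fin n → F⸨X⸩)}
    {G G' : Matrix (Fin k) (Fin n) F[X]} (hG : IsCanonical C G) (hG' : IsCanonical C G') :
    rowDeg G = rowDeg G' :=
  funext fun i => (hG.rowDeg_le_rowDeg hG' i).antisymm (hG'.rowDeg_le_rowDeg hG i)

/-! ### Independence and spanning in the state space -/

theorem coeff_shiftRow_ne_zero {G : Matrix (Fin k) (Fin n) F[X]} {i : Fin k} {a : ℤ} {j : Fin n}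
    {m : ℤ} (h : (shiftRow G i a j).coeff m ≠ 0) : a ≤ m ∧ m ≤ a + rowDeg G i := by
  simp only [shiftRow, Pi.smul_apply, smul_eq_mul, HahnSeries.coeff_single_mul, one_mul,
    laurentRow, coeff_algebraMap_polynomial] at h
  split_ifs at h with h0
  · exact absurd rfl h
  · have h1 := Polynomial.le_natDegree_of_ne_zero h
    have h2 : (G i j).natDegree ≤ rowDeg G i :=
      Finset.le_sup (f := fun j => (G i j).natDegree) (Finset.mem_univ j)
    omega

/-- The classes `[D^{-j} g_i]` with `1 ≤ j ≤ deg g_i`. -/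
noncomputable def stateGenerators {C : Submodule F⸨X⸩ (Fin n → F⸨X⸩)}
    {G : Matrix (Fin k) (Fin n) F[X]} (hG : IsPolyGeneratingMatrix C G)
    (x : Σ i : Fin k, Fin (rowDeg G i)) : StateSpace C :=
  stateClass C (shiftRow G x.1 (-((x.2 : ℤ) + 1))) (hG.shiftRow_mem x.1 _)

theorem IsCanonical.linearIndependent_stateGenerators {C : Submodule F⸨X⸩ (Fin n → F⸨X⸩)}
    {G : Matrix (Fin k) (Fin n) F[X]} (hG : IsCanonical C G) :
    LinearIndependent F (stateGenerators hG.isPolyGeneratingMatrix) := by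
  classical
  rw [Fintype.linearIndependent_iff]
  intro a ha
  let u : Fin k → F⸨X⸩ := fun i => ∑ j, a ⟨i, j⟩ • HahnSeries.single (-((j : ℤ) + 1)) (1 : F)
  let v : Fin n → F⸨X⸩ := ∑ x, a x • shiftRow G x.1 (-((x.2 : ℤ) + 1))
  have hv : v = ∑ i, u i • laurentRow G i := by
    simp only [v, u, Fintype.sum_sigma, Finset.sum_smul, shiftRow, smul_assoc]
  have hvC : v ∈ C := by
    rw [hv, ← hG.isPolyGeneratingMatrix.span_eq]
    exact (Submodule.mem_span_range_iff_exists_fun _).mpr ⟨u, rfl⟩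
  have hK : causalPartVec v ∈ C := by
    have h0 : (stateZero C).mkQ ⟨v, hvC⟩ = 0 := by
      rw [← ha]
      simp only [stateGenerators, stateClass, ← map_smul, ← map_sum]
      congr 1
      ext1
      simp [v]
    rw [Submodule.mkQ_apply, Submodule.Quotient.mk_eq_zero] at h0
    exact h0
  have hu_coeff : ∀ i (j : Fin (rowDeg G i)), (u i).coeff (-((j : ℤ) + 1)) = a ⟨i, j⟩ := by
    intro i j
    simp [u, HahnSeries.coeff_single, Fin.val_inj]
  obtain ⟨c, hc⟩ := (Submodule.mem_span_range_iff_exists_fun _).mp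
    (hG.isPolyGeneratingMatrix.span_eq.ge hK)
  have hu : u = 0 := by
    by_contra hne
    obtain ⟨i₀, hi₀⟩ := Function.ne_iff.mp hne
    obtain ⟨i, hi, hmax⟩ := Finset.exists_max_image (Finset.univ.filter fun i => u i ≠ 0)
      (rowDeg G) ⟨i₀, by simpa using hi₀⟩
    have hi : u i ≠ 0 := by simpa using hi
    have hpos : 0 < rowDeg G i := by
      by_contra h
      have : IsEmpty (Fin (rowDeg G i)) := by
        rw [Nat.eq_zero_of_not_pos h]; infer_instance
      exact hi (by simp [u])
    -- The upper bound is strict because every shift exponent is at most `-1`.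
    have hsupp : ∀ j m, (v j).coeff m ≠ 0 → -(rowDeg G i : ℤ) ≤ m ∧ m < rowDeg G i := by
      intro j m hm
      simp only [v, Finset.sum_apply, HahnSeries.coeff_sum, Pi.smul_apply,
        HahnSeries.coeff_smul] at hm
      obtain ⟨x, -, hx⟩ := Finset.exists_ne_zero_of_sum_ne_zero hm
      have hux : u x.1 ≠ 0 := by
        intro h
        apply left_ne_zero_of_smul hx
        rw [← hu_coeff x.1 x.2, h, HahnSeries.coeff_zero]
      have hle := hmax x.1 (by simpa using hux)
      have hb := coeff_shiftRow_ne_zero (right_ne_zero_of_smul hx)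
      have hlt := x.2.isLt
      omega
    have hKcoeff : ∀ j m, (causalPartVec v j).coeff m = if 0 ≤ m then (v j).coeff m else 0 :=
      fun j m => coeff_causalPart (v j) m
    have hci : c i = 0 := by
      refine hG.eq_zero_of_support hpos 0 c (fun j m hm => ?_) le_rfl
      rw [hc, hKcoeff, ne_eq, ite_eq_right_iff, Classical.not_imp] at hm
      have := hsupp j m hm.2
      omega
    -- The anticausal part `v - K(v)` has row coefficients `u l - c l`.
    have hdi : u i - c i = 0 := by
      refine hG.eq_zero_of_support hpos (-(rowDeg G i : ℤ)) (fun l => u l - c l)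
        (fun j m hm => ?_) le_rfl
      simp only [sub_smul, Finset.sum_sub_distrib, hc, ← hv, Pi.sub_apply,
        HahnSeries.coeff_sub, hKcoeff] at hm
      split_ifs at hm with h0
      · simp at hm
      · rw [sub_zero] at hm
        have := hsupp j m hm
        omega
    exact hi (by simpa [hci] using hdi)
  rintro ⟨i, j⟩
  rw [← hu_coeff, hu, Pi.zero_apply, HahnSeries.coeff_zero]

theorem IsPolyGeneratingMatrix.span_stateGenerators {C : Submodule F⸨X⸩ (Fin n → F⸨X⸩)}
    {G : Matrix (Fin k) (Fin n) F[X]} (hG : IsPolyGeneratingMatrix C G) :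
    Submodule.span F (Set.range (stateGenerators hG)) = ⊤ := by
  -- Codewords whose class lies in the span, viewed in the ambient space so that sums and scalars
  -- need no membership proofs.
  let T : Submodule F (Fin n → F⸨X⸩) :=
    ((Submodule.span F (Set.range (stateGenerators hG))).comap (stateZero C).mkQ).map
      (C.restrictScalars F).subtype
  have hT : ∀ x (hx : x ∈ C),
      stateClass C x hx ∈ Submodule.span F (Set.range (stateGenerators hG)) → x ∈ T :=
    fun x hx h => ⟨⟨x, hx⟩, h, rfl⟩
  have hzero : ∀ x ∈ C, causalPartVec x ∈ C → x ∈ T := by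
    intro x hx hKx
    refine hT x hx ?_
    have : stateClass C x hx = 0 := (Submodule.Quotient.mk_eq_zero _).mpr hKx
    rw [this]
    exact Submodule.zero_mem _
  have hrow : ∀ i, laurentRow G i ∈ C := fun i =>
    hG.span_eq ▸ Submodule.subset_span ⟨i, rfl⟩
  have hshift : ∀ i (m : ℕ), shiftRow G i (-((m : ℤ) + 1)) ∈ T := by
    intro i m
    by_cases hm : m < rowDeg G i
    · exact hT _ (hG.shiftRow_mem i _) (Submodule.subset_span ⟨⟨i, ⟨m, hm⟩⟩, rfl⟩)
    -- Here the shift exceeds the row degree, so only negative exponents remain.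
    · refine hzero _ (hG.shiftRow_mem i _) ?_
      convert C.zero_mem using 1
      ext j t
      change (causalPart _).coeff t = 0
      rw [coeff_causalPart, ite_eq_right_iff]
      intro ht
      by_contra h
      have := coeff_shiftRow_ne_zero h
      omega
  have hcausal : ∀ i (w : F⸨X⸩), causalPart w • laurentRow G i ∈ T := by
    intro i w
    refine hzero _ (C.smul_mem _ (hrow i)) ?_
    convert C.smul_mem (causalPart w) (hrow i) using 1
    ext j t
    change (causalPart (causalPart w * laurentRow G i j)).coeff t
      = (causalPart w * laurentRow G i j).coeff t
    rw [coeff_causalPart, ite_eq_left_iff]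
    intro ht
    rw [HahnSeries.coeff_mul]
    refine (Finset.sum_eq_zero fun x hx => ?_).symm
    obtain ⟨h1, h2, h3⟩ := Finset.mem_antidiagonal.mp hx
    rw [HahnSeries.mem_support] at h1 h2
    rw [coeff_causalPart, ne_eq, ite_eq_right_iff, Classical.not_imp] at h1
    rw [laurentRow, coeff_algebraMap_polynomial, ne_eq, ite_eq_left_iff, Classical.not_imp] at h2
    have := h1.1
    have := h2.1
    omega
  have hsmul : ∀ i (w : F⸨X⸩), w • laurentRow G i ∈ T := by
    intro i w
    -- A Laurent series has finitely many negative terms. If the order is positive, the extra terms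
    -- in this range are zero.
    have hw : w = causalPart w + ∑ m ∈ Finset.range w.order.natAbs,
        w.coeff (-((m : ℤ) + 1)) • HahnSeries.single (-((m : ℤ) + 1)) (1 : F) := by
      ext t
      simp only [HahnSeries.coeff_add, coeff_causalPart, HahnSeries.coeff_sum,
        HahnSeries.coeff_smul, HahnSeries.coeff_single]
      by_cases ht : 0 ≤ t
      · rw [if_pos ht, Finset.sum_eq_zero, add_zero]
        intro m _
        rw [if_neg (by omega), smul_zero]
      · rw [if_neg ht, zero_add]
        obtain ⟨m, rfl⟩ : ∃ m : ℕ, t = -((m : ℤ) + 1) := ⟨(-t - 1).toNat, by omega⟩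
        by_cases h : w.coeff (-((m : ℤ) + 1)) = 0
        · rw [h, Finset.sum_eq_zero]
          intro m' _
          split_ifs with hm
          · rw [← hm, h, zero_smul]
          · exact smul_zero _
        · have := HahnSeries.order_le_of_coeff_ne_zero h
          rw [Finset.sum_eq_single m]
          · simp
          · intro m' _ hm
            rw [if_neg (by omega), smul_zero]
          · intro hm
            exact absurd (Finset.mem_range.mpr (by omega)) hm
    rw [hw, add_smul, Finset.sum_smul]
    refine T.add_mem (hcausal i w) (T.sum_mem fun m _ => ?_)
    rw [smul_assoc]
    exact T.smul_mem _ (hshift i m)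
  rw [eq_top_iff]
  rintro x -
  obtain ⟨⟨v, hv⟩, rfl⟩ := (stateZero C).mkQ_surjective x
  have hvT : v ∈ T := by
    have hv' : v ∈ C := hv
    rw [← hG.span_eq, Submodule.mem_span_range_iff_exists_fun] at hv'
    obtain ⟨c, rfl⟩ := hv'
    exact T.sum_mem fun i _ => hsmul i (c i)
  obtain ⟨⟨v', hv'⟩, h, rfl⟩ := hvT
  exact h

end ConvCode

theorem theorem1 {F : Type*} [Field F] {n k : ℕ}
    (C : Submodule F⸨X⸩ (Fin n → F⸨X⸩)) (hC : ConvCode.IsConvolutionalCode k C)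
    (e : Fin k → ℕ) (he : ConvCode.IsForneyIndices C e)
    (G : Matrix (Fin k) (Fin n) F[X]) (hG : ConvCode.IsCanonical C G) :
    (∃ b : Module.Basis (Σ i : Fin k, Fin (e i)) F (ConvCode.StateSpace C),
      ∀ (i : Fin k) (j : Fin (e i)),
        b ⟨i, j⟩ = ConvCode.stateClass C (ConvCode.shiftRow G i (-((j : ℤ) + 1)))
          (hG.isPolyGeneratingMatrix.shiftRow_mem i (-((j : ℤ) + 1)))) ∧
    Module.rank F (ConvCode.StateSpace C) = ((∑ i, e i : ℕ) : Cardinal) := by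
  obtain ⟨G', hG', he'⟩ := he
  obtain rfl : ConvCode.rowDeg G = e := (hG.rowDeg_eq hG').trans (funext he')
  let b := Module.Basis.mk hG.linearIndependent_stateGenerators
    hG.isPolyGeneratingMatrix.span_stateGenerators.ge
  refine ⟨⟨b, fun i j => ?_⟩, ?_⟩
  · rw [Module.Basis.mk_apply]
    rfl
  · rw [rank_eq_card_basis b]
    simp
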